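/- **Setting.** An instance $\mathcal I$ of axis-aligned serial rectangle motion planning in the free plane ($\bigplus$-Rect-MP) consists of $k$ axis-aligned rectangular robots $R_1,\dots,R_k$ with widths $x(R_i)>0$ and heights $y(R_i)>0$, for each robot a starting and a final position of its center in $\mathbb R^2$, such that the starting rectangles have pairwise disjoint interiors and so do the final rectangles, and a number $\ell\in\mathbb N$. A move translates one robot by $\alpha v$ with $\alpha>0$ and $v\in\{(\pm1,0),(0,\pm1)\}$; it is collision-free if at no time of the translation the interior of the moving rectangle meets the interior of another (stationary) robot. A valid schedule is a finite sequence of collision-free moves, executed one after another, that takes every robot from its starting to its final position; its length is the number of its moves. It is optimal if no valid schedule is shorter. **The grid $G_{\mathcal I}$.** The basic vertical lines are the vertical lines through the starting and final positions of the centers of the robots. The vertical lines of $G_{\mathcal I}$ are the basic vertical lines together with, for every basic vertical line $b$ at $x$-coordinate $x(b)$, every robot of width $w_b$ whose starting or final center lies on $b$, every width $w$ of a robot, every $1\le i\le \ell$ and every multiset $\{R_{j_1},\dots,R_{j_{i-1}}\}$ of $i-1$ robots (repetitions allowed, empty for $i=1$), the two vertical lines with $x$-coordinates $$x(b)\pm\Bigl(\frac{w_b}{2}+\frac{w}{2}+\sum_{r=1}^{i-1}x(R_{j_r})\Bigr).$$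 (These are the possible lines of the center of the last robot in a stack of $i$ robots placed side by side against a robot on $b$.) The horizontal lines of $G_{\mathcal I}$ are defined analogously with $y$-coordinates and heights. The grid points are the intersections of a vertical and a horizontal line of $G_{\mathcal I}$. **Theorem.** Let $\mathcal I$ be an instance of $\bigplus$-Rect-MP with $k$ robots and move bound $\ell$. 1. If $\mathcal I$ has a valid schedule of length at most $\ell$, then $\mathcal I$ has an optimal schedule in which every move takes the center of the moving robot from a grid point of $G_{\mathcal I}$ to a grid point of $G_{\mathcal I}$ along a line of $G_{\mathcal I}$. 2. The number of vertical lines of $G_{\mathcal I}$ is at most $k^3\cdot 2^{k+\ell+1}$, and so is the number of horizontal lines. -/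

import Mathlib

/-- The closed axis-aligned rectangle of width `w` and height `h` with center `c`. -/
def centeredRect (w h : ℝ) (c : ℝ × ℝ) : Set (ℝ × ℝ) :=
  Set.Icc (c.1 - w / 2) (c.1 + w / 2) ×ˢ Set.Icc (c.2 - h / 2) (c.2 + h / 2)

/-- An instance of axis-aligned serial rectangle motion planning in the free plane with `k` robots:
`width i`, `height i` are the dimensions of the `i`-th robot, `start i` and `final i` the centers of
its starting and final rectangle, and `moveBound` is the number `ℓ` of allowed moves. -/
structure RectMP (k : ℕ) where
  width : Fin k → ℝ
  height : Fin k → ℝ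
  start : Fin k → ℝ × ℝ
  final : Fin k → ℝ × ℝ
  moveBound : ℕ
  width_pos : ∀ i, 0 < width i
  height_pos : ∀ i, 0 < height i
  start_disjoint : ∀ i j, i ≠ j →
    Disjoint (interior (centeredRect (width i) (height i) (start i)))
      (interior (centeredRect (width j) (height j) (start j)))
  final_disjoint : ∀ i j, i ≠ j →
    Disjoint (interior (centeredRect (width i) (height i) (final i)))
      (interior (centeredRect (width j) (height j) (final j)))

/-- The four axis-aligned unit vectors. -/
def axisDirections : Set (ℝ × ℝ) := {(-1, 0), (1, 0), (0, -1), (0, 1)}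

/-- A translation of one robot by the vector `dist • dir`. -/
structure RobotMove (k : ℕ) where
  robot : Fin k
  dir : ℝ × ℝ
  dist : ℝ

/-- The centers of all robots after a move, given the centers `p` before it. -/
noncomputable def RobotMove.apply {k : ℕ} (m : RobotMove k) (p : Fin k → ℝ × ℝ) :
    Fin k → ℝ × ℝ :=
  Function.update p m.robot (p m.robot + m.dist • m.dir)

namespace RectMP

variable {k : ℕ}

/-- The (closed) rectangle occupied by robot `i` when its center is at `c`. -/
def rect (I : RectMP k) (i : Fin k) (c : ℝ × ℝ) : Set (ℝ × ℝ) :=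
  centeredRect (I.width i) (I.height i) c

/-- With the robots centered at `p`, translating robot `i` by `v` makes it collide with the
stationary robot `j`. -/
def Collides (I : RectMP k) (p : Fin k → ℝ × ℝ) (i : Fin k) (v : ℝ × ℝ) (j : Fin k) : Prop :=
  ∃ t ∈ Set.Icc (0 : ℝ) 1,
    (interior (I.rect i (p i + t • v)) ∩ interior (I.rect j (p j))).Nonempty

/-- `m` is a collision-free axis-aligned move when the robots are centered at `p`. -/
def IsLegalMove (I : RectMP k) (p : Fin k → ℝ × ℝ) (m : RobotMove k) : Prop :=
  m.dir ∈ axisDirections ∧ 0 < m.dist ∧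
    ∀ j, j ≠ m.robot → ¬ I.Collides p m.robot (m.dist • m.dir) j

/-- `S` is a sequence of collision-free moves leading from the positions `p` to the positions
`q`. -/
def Leads (I : RectMP k) : (Fin k → ℝ × ℝ) → List (RobotMove k) → (Fin k → ℝ × ℝ) → Prop
  | p, [], q => p = q
  | p, m :: S, q => I.IsLegalMove p m ∧ I.Leads (m.apply p) S q

/-- `S` is a valid serial schedule for the instance. -/
def IsValidSchedule (I : RectMP k) (S : List (RobotMove k)) : Prop :=
  I.Leads I.start S I.final

/-- `S` is a valid serial schedule of minimum length. -/
def IsOptimalSchedule (I : RectMP k) (S : List (RobotMove k)) : Prop :=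
  I.IsValidSchedule S ∧ ∀ S', I.IsValidSchedule S' → S.length ≤ S'.length

/-- The lines, given by their coordinate, that are obtained from the basic lines and from stackings
on them. Here `s i` and `f i` are the relevant coordinate of the starting and the final center of
robot `i`, `d i` is the relevant dimension of robot `i`, and `n` is the maximum number of robots in
a stacking. A stacking on the basic line `b` of a robot `a` consists of the robots of a multiset `M`
followed by a last robot `c`; it yields the two possible lines of the center of `c`. -/
def lineCoords (s f d : Fin k → ℝ) (n : ℕ) : Set ℝ :=
  {x | ∃ a, x = s a ∨ x = f a} ∪
  {x | ∃ a b, (b = s a ∨ b = f a) ∧ ∃ c, ∃ M : Multiset (Fin k), M.card + 1 ≤ n ∧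
    (x = b + (d a / 2 + d c / 2 + (M.map d).sum) ∨
      x = b - (d a / 2 + d c / 2 + (M.map d).sum))}

/-- The vertical lines of the grid, given by their `x`-coordinates. -/
def verticalLines (I : RectMP k) : Set ℝ :=
  lineCoords (fun i => (I.start i).1) (fun i => (I.final i).1) I.width I.moveBound

/-- The horizontal lines of the grid, given by their `y`-coordinates. -/
def horizontalLines (I : RectMP k) : Set ℝ :=
  lineCoords (fun i => (I.start i).2) (fun i => (I.final i).2) I.height I.moveBound

/-- The grid points: intersections of a vertical and a horizontal grid line. -/
def gridPoints (I : RectMP k) : Set (ℝ × ℝ) := I.verticalLines ×ˢ I.horizontalLines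

/-- The grid, as a set of lines of the plane. -/
def gridLines (I : RectMP k) : Set (Set (ℝ × ℝ)) :=
  {L | (∃ x ∈ I.verticalLines, L = {q | q.1 = x}) ∨
    (∃ y ∈ I.horizontalLines, L = {q | q.2 = y})}

/-- When the schedule `S` is executed from the positions `p`, every move takes the center of the
moved robot from a grid point to a grid point along a grid line. -/
def MovesOnGrid (I : RectMP k) : (Fin k → ℝ × ℝ) → List (RobotMove k) → Prop
  | _, [] => True
  | p, m :: S =>
    (p m.robot ∈ I.gridPoints ∧ m.apply p m.robot ∈ I.gridPoints ∧
      ∃ L ∈ I.gridLines, segment ℝ (p m.robot) (m.apply p m.robot) ⊆ L) ∧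
    I.MovesOnGrid (m.apply p) S

end RectMP

/-!
The two coordinates of a schedule can be changed independently of each other. Fix a shortest
schedule and let `X i` be a map that assigns a new `x`-coordinate to every `x`-coordinate `a` at
which robot `i` is ever centered, and `Y i` such a map for the `y`-coordinates. Replacing all centers
accordingly keeps the schedule valid provided that every `X i` is monotone, that `X` fixes the
starting and the final coordinates, and that `X` keeps two robots apart wherever their
`x`-projections have disjoint interiors (and likewise for `Y`). Indeed, the area swept by an
axis-parallel move is again a rectangle, so the move is collision-free if and only if one of the two
projections separates this rectangle from each stationary robot (`RectMP.not_collides_iff`). Moves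
whose new length is zero are dropped, so that the new schedule is no longer than the old one, hence
still optimal (`RectMP.Leads.exists_on_grid`).

It remains to choose `X` with values on the lines of the grid (`RectMP.exists_lineCoords_map`). The
requirements form a system of difference constraints on the finitely many pairs `(i, a)`, and the old
coordinates solve it. Each pair that a chain of constraints bounds from below by a starting or final
pair gets the least possible value, that is, the length of a longest chain
(`exists_stack_from_fixed`): such a chain is a stack of robots placed to the right of a robot on a
basic line. The other pairs are not constrained from the left. They are stacked to the left of a
wall, the leftmost left edge of all starting and final rectangles, which is not to the right of the
left edge of any stack of the first kind (`exists_stack`). The constraints are strict for the old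
coordinates, so a chain never repeats a pair; as each move creates at most one new pair, a stack has
at most as many robots as the schedule has moves.

The number of lines is bounded by counting the multisets of at most `ℓ - 1` of the `k` robots, of
which there are `(k + ℓ - 1).choose (ℓ - 1)` (`RectMP.encard_lineCoords_le`).
-/

/-! ### Tight stacks under difference constraints -/

/-- The constraint that `u` stays below `v` by at least `gap u v`. It is imposed whenever the
coordinates `z` satisfy it with `z u < z v`; the strictness matters when `gap u v = 0`, and makes
the relation acyclic. -/
def StackEdge {V : Type*} (gap : V → V → ℝ) (z : V → ℝ) (u v : V) : Prop :=
  z u < z v ∧ z u + gap u v ≤ z v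

/-- The least solution of the constraints with prescribed values on `F`, when every element outside
`F` is bounded from below. Here `s v` is half the size of `v`; a constraint says either that two
objects do not overlap (`gap u v = s u + s v`) or that two positions of one object are ordered
(`gap u v = 0`). Each value is attained by a tight chain of constraints from some `b ∈ F`, and `T`
is the set of the intermediate objects of the resulting stack. -/
theorem exists_stack_from_fixed {V : Type*} (s : V → ℝ) (gap : V → V → ℝ) (z : V → ℝ)
    (hgap : ∀ u v, (gap u v = 0 ∧ s u = s v) ∨ gap u v = s u + s v) (F : Set V) (P : Finset V)
    (hpred : ∀ v ∈ P, v ∉ F → ∃ u ∈ P, StackEdge gap z u v) :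
    ∃ X : V → ℝ, (∀ v ∈ P, v ∈ F → X v = z v) ∧ (∀ v ∈ P, X v ≤ z v) ∧
      (∀ u ∈ P, ∀ v ∈ P, StackEdge gap z u v → X u + gap u v ≤ X v) ∧
      ∀ v ∈ P, ∃ b ∈ P, b ∈ F ∧ ((X v = z b ∧ s b = s v) ∨
        (v ∉ F ∧ ∃ T ⊆ P, (∀ w ∈ T, w ∉ F ∧ z w < z v) ∧
          X v = z b + (s b + s v + ∑ w ∈ T, 2 * s w))) := by
  classical
  -- The elements are placed in the order of `z`, which is compatible with the constraints.
  induction P using Finset.induction_on_max_value z with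
  | empty => exact ⟨z, by simp⟩
  | insert v P hv hmax ih =>
    have hold : ∀ u ∈ insert v P, ∀ w ∈ insert v P, StackEdge gap z u w → u ∈ P := by
      intro u hu w hw h
      rcases Finset.mem_insert.1 hu with rfl | hu
      · rcases Finset.mem_insert.1 hw with rfl | hw
        · exact absurd h.1 (lt_irrefl _)
        · exact absurd h.1 (not_lt.2 (hmax w hw))
      · exact hu
    obtain ⟨X, hXF, hXz, hXe, hXs⟩ := ih (fun w hw hwF => by
      obtain ⟨u, hu, h⟩ := hpred w (Finset.mem_insert_of_mem hw) hwF
      exact ⟨u, hold u hu w (Finset.mem_insert_of_mem hw) h, h⟩)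
    have hne : ∀ {w}, w ∈ P → w ≠ v := fun hw h => hv (h ▸ hw)
    suffices key : ∃ a : ℝ, (v ∈ F → a = z v) ∧ a ≤ z v ∧
        (∀ u ∈ P, StackEdge gap z u v → X u + gap u v ≤ a) ∧
        ∃ b ∈ insert v P, b ∈ F ∧ ((a = z b ∧ s b = s v) ∨
          (v ∉ F ∧ ∃ T ⊆ P, (∀ w ∈ T, w ∉ F ∧ z w < z v) ∧
            a = z b + (s b + s v + ∑ w ∈ T, 2 * s w))) by
      obtain ⟨a, haF, haz, hae, b, hb, hbF, has⟩ := key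
      refine ⟨Function.update X v a, ?_, ?_, ?_, ?_⟩
      · intro w hw hwF
        rcases Finset.mem_insert.1 hw with rfl | hw
        · simpa using haF hwF
        · simpa [hne hw] using hXF w hw hwF
      · intro w hw
        rcases Finset.mem_insert.1 hw with rfl | hw
        · simpa using haz
        · simpa [hne hw] using hXz w hw
      · intro u hu w hw h
        have huP := hold u hu w hw h
        rcases Finset.mem_insert.1 hw with rfl | hw
        · simpa [hne huP] using hae u huP h
        · simpa [hne huP, hne hw] using hXe u huP w hw h
      · intro w hw
        rcases Finset.mem_insert.1 hw with rfl | hw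
        · refine ⟨b, hb, hbF, ?_⟩
          rw [Function.update_self]
          refine has.imp_right ?_
          rintro ⟨h1, T, hT, h⟩
          exact ⟨h1, T, hT.trans (Finset.subset_insert _ _), h⟩
        · obtain ⟨c, hc, hcF, h⟩ := hXs w hw
          refine ⟨c, Finset.mem_insert_of_mem hc, hcF, ?_⟩
          rw [Function.update_of_ne (hne hw)]
          refine h.imp_right ?_
          rintro ⟨h1, T, hT, h⟩
          exact ⟨h1, T, hT.trans (Finset.subset_insert _ _), h⟩
    by_cases hvF : v ∈ F
    · refine ⟨z v, fun _ => rfl, le_rfl, ?_, v, Finset.mem_insert_self _ _, hvF, Or.inl ⟨rfl, rfl⟩⟩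
      intro u hu h
      linarith [hXz u hu, h.2]
    · set Q := P.filter fun u => StackEdge gap z u v with hQ
      have hQne : Q.Nonempty := by
        obtain ⟨u, hu, h⟩ := hpred v (Finset.mem_insert_self _ _) hvF
        exact ⟨u, Finset.mem_filter.2 ⟨hold u hu v (Finset.mem_insert_self _ _) h, h⟩⟩
      obtain ⟨u, huQ, humax⟩ := Q.exists_max_image (fun u => X u + gap u v) hQne
      obtain ⟨huP, hue⟩ := Finset.mem_filter.1 huQ
      obtain ⟨b, hb, hbF, hs⟩ := hXs u huP
      refine ⟨X u + gap u v, fun h => absurd h hvF, by linarith [hXz u huP, hue.2],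
        fun w hw h => humax w (Finset.mem_filter.2 ⟨hw, h⟩), b, Finset.mem_insert_of_mem hb, hbF, ?_⟩
      rcases hgap u v with ⟨hg, hsuv⟩ | hg
      · rw [hg, add_zero, ← hsuv]
        refine hs.imp_right ?_
        rintro ⟨-, T, hT, hTF, h⟩
        exact ⟨hvF, T, hT, fun w hw => ⟨(hTF w hw).1, (hTF w hw).2.trans hue.1⟩, h⟩
      · refine Or.inr ⟨hvF, ?_⟩
        rcases hs with ⟨h1, h2⟩ | ⟨huF, T, hT, hTF, h⟩
        · exact ⟨∅, by simp, by simp, by simp [h1, h2, hg]⟩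
        · refine ⟨insert u T, Finset.insert_subset huP hT, ?_, ?_⟩
          · intro w hw
            rcases Finset.mem_insert.1 hw with rfl | hw
            · exact ⟨huF, hue.1⟩
            · exact ⟨(hTF w hw).1, (hTF w hw).2.trans hue.1⟩
          · rw [Finset.sum_insert fun hu => lt_irrefl _ (hTF u hu).2, h, hg]
            ring

/-- A solution of the constraints with prescribed values on `F`, in which every element lies in a
stack that starts at an element of `F` and extends in a single direction. -/
theorem exists_stack {V : Type*} [DecidableEq V] (s : V → ℝ) (hs : ∀ v, 0 < s v)
    (gap : V → V → ℝ) (z : V → ℝ)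
    (hgap : ∀ u v, (gap u v = 0 ∧ s u = s v) ∨ gap u v = s u + s v)
    (F P : Finset V) (hFP : F ⊆ P) (hF : F.Nonempty) :
    ∃ X : V → ℝ, (∀ v ∈ F, X v = z v) ∧
      (∀ u ∈ P, ∀ v ∈ P, StackEdge gap z u v → X u + gap u v ≤ X v) ∧
      ∀ v ∈ P, ∃ b ∈ F, X v = z b ∨ ∃ T : Finset V, T.card + 1 ≤ (P \ F).card ∧
        (X v = z b + (s b + s v + ∑ w ∈ T, 2 * s w) ∨
          X v = z b - (s b + s v + ∑ w ∈ T, 2 * s w)) := by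
  classical
  have hcard : ∀ v ∈ P, v ∉ F → ∀ T ⊆ P, (∀ w ∈ T, w ∉ F) → v ∉ T →
      T.card + 1 ≤ (P \ F).card := by
    intro v hv hvF T hT hTF hvT
    rw [← Finset.card_insert_of_notMem hvT]
    refine Finset.card_le_card fun w hw => ?_
    rcases Finset.mem_insert.1 hw with rfl | hw
    · exact Finset.mem_sdiff.2 ⟨hv, hvF⟩
    · exact Finset.mem_sdiff.2 ⟨hT hw, hTF w hw⟩
  -- `A` consists of the elements that a chain of constraints bounds from below by a fixed one.
  set A := P.filter fun v =>
    ∃ b ∈ F, Relation.ReflTransGen (fun u w => u ∈ P ∧ StackEdge gap z u w) b v with hA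
  have hAP : A ⊆ P := Finset.filter_subset _ _
  have hFA : F ⊆ A := fun v hv => Finset.mem_filter.2 ⟨hFP hv, v, hv, .refl⟩
  have hAc : ∀ u ∈ A, ∀ v ∈ P, StackEdge gap z u v → v ∈ A := by
    intro u hu v hv h
    obtain ⟨huP, b, hb, hbu⟩ := Finset.mem_filter.1 hu
    exact Finset.mem_filter.2 ⟨hv, b, hb, hbu.tail ⟨huP, h⟩⟩
  obtain ⟨X₁, h1F, -, h1e, h1s⟩ := exists_stack_from_fixed s gap z hgap (F : Set V) A (by
    intro v hv hvF
    obtain ⟨hvP, b, hb, hbv⟩ := Finset.mem_filter.1 hv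
    rcases Relation.ReflTransGen.cases_tail hbv with rfl | ⟨u, hbu, huP, h⟩
    · exact absurd hb hvF
    · exact ⟨u, Finset.mem_filter.2 ⟨huP, b, hb, hbu⟩, h⟩)
  -- The fixed element `a` with the leftmost left edge serves as a wall for the other elements.
  obtain ⟨a, haF, hamin⟩ := F.exists_min_image (fun b => z b - s b) hF
  have hedge : ∀ v ∈ A, z a - s a + s v ≤ X₁ v := by
    intro v hv
    obtain ⟨b, hb, hbF, ⟨h, h'⟩ | ⟨-, T, -, -, h⟩⟩ := h1s v hv
    · linarith [hamin b hbF]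
    · have := Finset.sum_nonneg (s := T) (f := fun w => 2 * s w) fun w _ => by
        linarith [hs w]
      linarith [hamin b hbF, hs b]
  set U := P \ A with hU
  have haU : a ∉ U := fun h => (Finset.mem_sdiff.1 h).2 (hFA haF)
  have hUa : ∀ {u}, u ∈ U → u ≠ a := fun hu h => haU (h ▸ hu)
  -- Moving all elements of `U` to the left by the same amount preserves the constraints, since none
  -- bounds an element of `U` from below by one of `A`. So they may be assumed to lie left of the wall.
  obtain ⟨K, hK⟩ : ∃ K, ∀ u ∈ U, z u - z a + s a + s u ≤ K := by
    obtain ⟨K, hK⟩ := (U.image fun u => z u - z a + s a + s u).bddAbove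
    exact ⟨K, fun u hu => hK (Finset.mem_coe.2 (Finset.mem_image_of_mem _ hu))⟩
  -- The reflected problem, whose only fixed element is `a`. The gap from `a` is the full one even to
  -- other positions of the same object, because the wall is an edge of `a` and not its center.
  set gap' : V → V → ℝ := fun u v => if u = a then s u + s v else gap v u with hgap'
  set z' : V → ℝ := fun u => if u = a then - z a else K - z u with hz'
  have hwall : ∀ u ∈ U, StackEdge gap' z' a u := by
    intro u hu
    have := hK u hu
    have := hs a
    have := hs u
    simp only [StackEdge, hgap', hz', hUa hu, if_true, if_false]
    constructor <;> linarith
  obtain ⟨X₂, h2F, -, h2e, h2s⟩ := exists_stack_from_fixed s gap' z' (by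
    intro u v
    by_cases hu : u = a
    · exact Or.inr (by simp [hgap', hu])
    · rcases hgap v u with ⟨h, h'⟩ | h
      · exact Or.inl ⟨by simp [hgap', hu, h], h'.symm⟩
      · exact Or.inr (by simp [hgap', hu, h, add_comm])) {a} (insert a U) (by
    intro v hv hva
    exact ⟨a, Finset.mem_insert_self _ _,
      hwall v ((Finset.mem_insert.1 hv).resolve_left hva)⟩)
  have h2a : X₂ a = - z a := by
    rw [h2F a (Finset.mem_insert_self _ _) rfl]; simp [hz']
  have h2w : ∀ u ∈ U, - z a + (s a + s u) ≤ X₂ u := by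
    intro u hu
    have := h2e a (Finset.mem_insert_self _ _) u (Finset.mem_insert_of_mem hu) (hwall u hu)
    simpa only [h2a, hgap', if_true] using this
  refine ⟨fun v => if v ∈ A then X₁ v else - X₂ v, ?_, ?_, ?_⟩
  · intro v hv
    simpa [hFA hv] using h1F v (hFA hv) hv
  · intro u hu v hv h
    by_cases huA : u ∈ A
    · have hvA := hAc u huA v hv h
      simpa [huA, hvA] using h1e u huA v hvA h
    · have huU : u ∈ U := Finset.mem_sdiff.2 ⟨hu, huA⟩
      by_cases hvA : v ∈ A
      · have : gap u v ≤ s u + s v := by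
          rcases hgap u v with ⟨h, -⟩ | h
          · linarith [hs u, hs v]
          · exact h.le
        simp only [huA, hvA, if_true, if_false]
        linarith [h2w u huU, hedge v hvA]
      · have hvU : v ∈ U := Finset.mem_sdiff.2 ⟨hv, hvA⟩
        have := h2e v (Finset.mem_insert_of_mem hvU) u (Finset.mem_insert_of_mem huU) (by
          simp only [StackEdge, hgap', hz', hUa huU, hUa hvU, if_false]
          constructor <;> linarith [h.1, h.2])
        simp only [hgap', hUa hvU, if_false] at this
        simp only [huA, hvA, if_false]
        linarith
  · intro v hv
    by_cases hvA : v ∈ A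
    · simp only [hvA, if_true]
      obtain ⟨b, hb, hbF, ⟨h, -⟩ | ⟨hvF, T, hT, hTF, h⟩⟩ := h1s v hvA
      · exact ⟨b, hbF, Or.inl h⟩
      · exact ⟨b, hbF, Or.inr ⟨T, hcard v hv hvF T (hT.trans hAP) (fun w hw => (hTF w hw).1)
          fun h => lt_irrefl _ (hTF v h).2, Or.inl h⟩⟩
    · have hvU : v ∈ U := Finset.mem_sdiff.2 ⟨hv, hvA⟩
      have hUF : ∀ {w}, w ∈ U → w ∉ F := fun hw h => (Finset.mem_sdiff.1 hw).2 (hFA h)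
      simp only [hvA, if_false]
      obtain ⟨b, hb, rfl, ⟨h, -⟩ | ⟨-, T, hT, hTF, h⟩⟩ := h2s v (Finset.mem_insert_of_mem hvU)
      · have := h2w v hvU
        rw [h] at this
        simp only [hz', if_true] at this
        linarith [hs b, hs v]
      · have hTU : ∀ w ∈ T, w ∈ U := fun w hw =>
          (Finset.mem_insert.1 (hT hw)).resolve_left (hTF w hw).1
        refine ⟨b, haF, Or.inr ⟨T, hcard v hv (hUF hvU) T
          (fun w hw => (Finset.mem_sdiff.1 (hTU w hw)).1) (fun w hw => hUF (hTU w hw))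
          fun h => lt_irrefl _ (hTF v h).2, Or.inr ?_⟩⟩
        rw [h]
        simp only [hz', if_true]
        ring

namespace RectMP

variable {k : ℕ}

/-- A change of coordinates that moves all the positions in `P` to lines of the grid, fixes the
starting and final positions, and preserves the order of the positions of each robot as well as the
separation of any two robots. -/
theorem exists_lineCoords_map (s f d : Fin k → ℝ) (hd : ∀ i, 0 < d i) (n : ℕ)
    (P : Finset (Fin k × ℝ)) (hsP : ∀ i, (i, s i) ∈ P) (hfP : ∀ i, (i, f i) ∈ P)
    (hP : (P \ Finset.univ.image fun i => (i, s i)).card ≤ n) :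
    ∃ X : Fin k → ℝ → ℝ, (∀ i, X i (s i) = s i) ∧ (∀ i, X i (f i) = f i) ∧
      (∀ i a b, (i, a) ∈ P → (i, b) ∈ P → a ≤ b → X i a ≤ X i b) ∧
      (∀ i j a b, i ≠ j → (i, a) ∈ P → (j, b) ∈ P → a + (d i + d j) / 2 ≤ b →
        X i a + (d i + d j) / 2 ≤ X j b) ∧
      ∀ i a, (i, a) ∈ P → X i a ∈ lineCoords s f d n := by
  classical
  rcases P.eq_empty_or_nonempty with rfl | ⟨⟨i₀, -⟩, -⟩
  · exact ⟨fun _ => id, by simp, by simp, by simp, by simp, by simp⟩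
  set F : Finset (Fin k × ℝ) :=
    (Finset.univ.image fun i => (i, s i)) ∪ Finset.univ.image fun i => (i, f i) with hF
  have hsF : ∀ i, (i, s i) ∈ F := fun i => by simp [hF]
  have hfF : ∀ i, (i, f i) ∈ F := fun i => by simp [hF]
  have hFP : F ⊆ P := by
    intro v hv
    simp only [hF, Finset.mem_union, Finset.mem_image, Finset.mem_univ, true_and] at hv
    rcases hv with ⟨i, rfl⟩ | ⟨i, rfl⟩
    exacts [hsP i, hfP i]
  obtain ⟨X, hXF, hXe, hXs⟩ := exists_stack (fun v : Fin k × ℝ => d v.1 / 2)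
    (fun v => half_pos (hd v.1)) (fun u v => if u.1 = v.1 then 0 else d u.1 / 2 + d v.1 / 2)
    Prod.snd (fun u v => by
      by_cases h : u.1 = v.1
      · exact Or.inl ⟨by simp [h], by simp [h]⟩
      · exact Or.inr (by simp [h])) F P hFP ⟨_, hsF i₀⟩
  refine ⟨fun i a => X (i, a), fun i => hXF _ (hsF i), fun i => hXF _ (hfF i), ?_, ?_, ?_⟩
  · intro i a b ha hb hab
    rcases hab.eq_or_lt with rfl | hab
    · exact le_rfl
    · simpa using hXe _ ha _ hb ⟨hab, by simpa using hab.le⟩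
  · intro i j a b hij ha hb hab
    have hi := hd i
    have hj := hd j
    have h := hXe _ ha _ hb ⟨show a < b by linarith, by simp only [hij, if_false]; linarith⟩
    simp only [hij, if_false] at h
    linarith
  · intro i a ha
    obtain ⟨b, hbF, h⟩ := hXs _ ha
    have hb : b.2 = s b.1 ∨ b.2 = f b.1 := by
      simp only [hF, Finset.mem_union, Finset.mem_image, Finset.mem_univ, true_and] at hbF
      rcases hbF with ⟨i, rfl⟩ | ⟨i, rfl⟩
      exacts [Or.inl rfl, Or.inr rfl]
    rcases h with h | ⟨T, hT, h⟩
    · exact Or.inl ⟨b.1, by simpa only [h] using hb⟩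
    · refine Or.inr ⟨b.1, b.2, hb, i, T.val.map Prod.fst, ?_, ?_⟩
      · rw [Multiset.card_map]
        refine hT.trans (le_trans (Finset.card_le_card ?_) hP)
        exact Finset.sdiff_subset_sdiff subset_rfl Finset.subset_union_left
      · have hsum : ∑ w ∈ T, 2 * (d w.1 / 2) = ((T.val.map Prod.fst).map d).sum := by
          rw [Multiset.map_map]
          exact Finset.sum_congr rfl fun w _ => by simp; ring
        simpa only [hsum] using h

/-! ### Collision-free moves -/

/-- The points `a` and `a'` lie on the same side of `b`, at distance at least `W`. For `W` the mean
of the widths of two robots this says that one of them, when moving from `a` to `a'`, does not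
touch the interior of the other one at `b` in the projection to this coordinate. -/
def SameSide (W a a' b : ℝ) : Prop :=
  (a + W ≤ b ∧ a' + W ≤ b) ∨ (b + W ≤ a ∧ b + W ≤ a')

/-- A point moving from `a` to `a'` that is not kept on one side of `b` is at some time closer than
`W` to `b`. -/
theorem exists_abs_lt_of_not_sameSide {W a a' b : ℝ} (hW : 0 < W) (h : ¬ SameSide W a a' b) :
    ∃ t ∈ Set.Icc (0 : ℝ) 1, |a + t * (a' - a) - b| < W := by
  simp only [SameSide, not_or, not_and_or, not_le] at h
  by_cases h0 : |a - b| < W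
  · exact ⟨0, by simp, by simpa using h0⟩
  by_cases h1 : |a' - b| < W
  · exact ⟨1, by simp, by simpa using h1⟩
  -- The endpoints are on different sides of `b`, so the moving point passes through `b`.
  have hne : a' - a ≠ 0 := by
    intro h'
    obtain rfl : a' = a := by linarith
    simp only [or_self] at h
    exact h0 (abs_lt.2 ⟨by linarith, by linarith⟩)
  refine ⟨(b - a) / (a' - a), ?_, by rw [div_mul_cancel₀ _ hne]; simpa using hW⟩
  rw [not_lt, le_abs] at h0 h1
  rcases lt_or_gt_of_ne hne with hlt | hgt
  · rw [Set.mem_Icc, div_le_one_of_neg hlt]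
    refine ⟨div_nonneg_of_nonpos ?_ hlt.le, ?_⟩ <;>
    rcases h0 with h0 | h0 <;> rcases h1 with h1 | h1 <;>
    rcases h with ⟨h2 | h2, h3 | h3⟩ <;> linarith
  · rw [Set.mem_Icc, div_le_one hgt]
    refine ⟨div_nonneg ?_ hgt.le, ?_⟩ <;>
    rcases h0 with h0 | h0 <;> rcases h1 with h1 | h1 <;>
    rcases h with ⟨h2 | h2, h3 | h3⟩ <;> linarith

theorem SameSide.not_abs_lt {W a a' b t : ℝ} (h : SameSide W a a' b)
    (ht : t ∈ Set.Icc (0 : ℝ) 1) : ¬ |a + t * (a' - a) - b| < W := by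
  obtain ⟨h0, h1⟩ := ht
  rw [not_lt, le_abs]
  rcases h with ⟨h, h'⟩ | ⟨h, h'⟩
  · exact Or.inr (by nlinarith)
  · exact Or.inl (by nlinarith)

theorem interior_centeredRect_inter_nonempty {w h w' h' : ℝ} (hw : 0 < w) (hh : 0 < h)
    (hw' : 0 < w') (hh' : 0 < h') (c c' : ℝ × ℝ) :
    (interior (centeredRect w h c) ∩ interior (centeredRect w' h' c')).Nonempty ↔
      |c.1 - c'.1| < (w + w') / 2 ∧ |c.2 - c'.2| < (h + h') / 2 := by
  simp only [centeredRect, interior_prod_eq, interior_Icc, Set.prod_inter_prod,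
    Set.prod_nonempty_iff, Set.Ioo_inter_Ioo, Set.nonempty_Ioo, sup_lt_iff, lt_inf_iff, abs_lt]
  constructor
  · rintro ⟨⟨⟨_, _⟩, _, _⟩, ⟨_, _⟩, _, _⟩
    refine ⟨⟨?_, ?_⟩, ?_, ?_⟩ <;> linarith
  · rintro ⟨⟨_, _⟩, _, _⟩
    refine ⟨⟨⟨?_, ?_⟩, ?_, ?_⟩, ⟨?_, ?_⟩, ?_, ?_⟩ <;> linarith

/-- An axis-parallel move is collision-free if and only if one of the two coordinates separates the
swept rectangle from the stationary one. -/
theorem not_collides_iff (I : RectMP k) (p : Fin k → ℝ × ℝ) (i j : Fin k) (v : ℝ × ℝ)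
    (hv : v.1 = 0 ∨ v.2 = 0) :
    ¬ I.Collides p i v j ↔
      SameSide ((I.width i + I.width j) / 2) (p i).1 ((p i).1 + v.1) (p j).1 ∨
      SameSide ((I.height i + I.height j) / 2) (p i).2 ((p i).2 + v.2) (p j).2 := by
  have hw := I.width_pos i
  have hw' := I.width_pos j
  have hh := I.height_pos i
  have hh' := I.height_pos j
  have hcol : I.Collides p i v j ↔ ∃ t ∈ Set.Icc (0 : ℝ) 1,
      |(p i).1 + t * ((p i).1 + v.1 - (p i).1) - (p j).1| < (I.width i + I.width j) / 2 ∧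
      |(p i).2 + t * ((p i).2 + v.2 - (p i).2) - (p j).2| < (I.height i + I.height j) / 2 := by
    simp only [Collides, rect, interior_centeredRect_inter_nonempty hw hh hw' hh',
      Prod.fst_add, Prod.snd_add, Prod.smul_fst, Prod.smul_snd, smul_eq_mul, add_sub_cancel_left]
  rw [hcol]
  constructor
  · contrapose!
    rintro ⟨hx, hy⟩
    obtain ⟨t, ht, h1⟩ := exists_abs_lt_of_not_sameSide (by linarith) hx
    obtain ⟨t', ht', h2⟩ := exists_abs_lt_of_not_sameSide (by linarith) hy
    rcases hv with hv | hv
    · exact ⟨t', ht', by simpa [hv] using h1, h2⟩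
    · exact ⟨t, ht, h1, by simpa [hv] using h2⟩
  · rintro h ⟨t, ht, h1, h2⟩
    exact h.elim (fun h => h.not_abs_lt ht h1) fun h => h.not_abs_lt ht h2

/-! ### Moving a schedule to the grid -/

/-- The pairs of a robot `i` and a value of `π` at a center of `i` that occur when the schedule `S`
is executed from `p`; `π` is meant to be one of the two coordinates. -/
noncomputable def visited (π : ℝ × ℝ → ℝ) :
    (Fin k → ℝ × ℝ) → List (RobotMove k) → Finset (Fin k × ℝ)
  | p, [] => Finset.univ.image fun i => (i, π (p i))
  | p, m :: S => (Finset.univ.image fun i => (i, π (p i))) ∪ visited π (m.apply p) S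

theorem mem_visited (π : ℝ × ℝ → ℝ) (p : Fin k → ℝ × ℝ) (S : List (RobotMove k)) (i : Fin k) :
    (i, π (p i)) ∈ visited π p S := by
  cases S <;> simp [visited]

theorem Leads.mem_visited_end {I : RectMP k} (π : ℝ × ℝ → ℝ) {p q : Fin k → ℝ × ℝ}
    {S : List (RobotMove k)} (h : I.Leads p S q) (i : Fin k) : (i, π (q i)) ∈ visited π p S := by
  induction S generalizing p with
  | nil => obtain rfl : p = q := h; exact mem_visited π p [] i
  | cons m S ih => exact Finset.mem_union_right _ (ih h.2)

/-- Each move adds at most one new coordinate. -/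
theorem card_visited_sdiff_le (π : ℝ × ℝ → ℝ) (p : Fin k → ℝ × ℝ) (S : List (RobotMove k)) :
    (visited π p S \ Finset.univ.image fun i => (i, π (p i))).card ≤ S.length := by
  induction S generalizing p with
  | nil => simp [visited]
  | cons m S ih =>
    have hsub : visited π p (m :: S) \ (Finset.univ.image fun i => (i, π (p i))) ⊆
        insert (m.robot, π (m.apply p m.robot))
          (visited π (m.apply p) S \ Finset.univ.image fun i => (i, π (m.apply p i))) := by
      rintro ⟨j, a⟩ h
      simp only [visited, Finset.mem_sdiff, Finset.mem_union, Finset.mem_image, Finset.mem_univ,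
        true_and, Prod.mk.injEq, exists_eq_left, Finset.mem_insert] at h ⊢
      obtain ⟨h | h, h'⟩ := h
      · exact absurd h h'
      · by_cases hj : j = m.robot
        · subst hj
          by_cases ha : a = π (m.apply p m.robot)
          · exact Or.inl ⟨rfl, ha⟩
          · exact Or.inr ⟨h, fun h => ha h.symm⟩
        · exact Or.inr ⟨h, by simpa [RobotMove.apply, hj] using h'⟩
    calc _ ≤ _ := Finset.card_le_card hsub
      _ ≤ _ := Finset.card_insert_le _ _
      _ ≤ S.length + 1 := Nat.succ_le_succ (ih _)

theorem SameSide.map {d : Fin k → ℝ} {P : Finset (Fin k × ℝ)} {X : Fin k → ℝ → ℝ}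
    (hX : ∀ i j a b, i ≠ j → (i, a) ∈ P → (j, b) ∈ P → a + (d i + d j) / 2 ≤ b →
        X i a + (d i + d j) / 2 ≤ X j b) {i j : Fin k} (hij : i ≠ j) {a a' b : ℝ}
    (ha : (i, a) ∈ P) (ha' : (i, a') ∈ P) (hb : (j, b) ∈ P)
    (h : SameSide ((d i + d j) / 2) a a' b) :
    SameSide ((d i + d j) / 2) (X i a) (X i a') (X j b) := by
  refine h.imp (fun h => ⟨hX i j a b hij ha hb h.1, hX i j a' b hij ha' hb h.2⟩) fun h => ?_
  rw [add_comm (d i)] at h ⊢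
  exact ⟨hX j i b a hij.symm hb ha h.1, hX j i b a' hij.symm hb ha' h.2⟩

/-- Maps `X` and `Y` as provided by `exists_lineCoords_map` turn a sequence of collision-free moves
into one along the grid that is not longer. -/
theorem Leads.exists_on_grid {I : RectMP k} {P Q : Finset (Fin k × ℝ)} {X Y : Fin k → ℝ → ℝ}
    (hXm : ∀ i a b, (i, a) ∈ P → (i, b) ∈ P → a ≤ b → X i a ≤ X i b)
    (hXs : ∀ i j a b, i ≠ j → (i, a) ∈ P → (j, b) ∈ P →
      a + (I.width i + I.width j) / 2 ≤ b → X i a + (I.width i + I.width j) / 2 ≤ X j b)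
    (hXl : ∀ i a, (i, a) ∈ P → X i a ∈ I.verticalLines)
    (hYm : ∀ i a b, (i, a) ∈ Q → (i, b) ∈ Q → a ≤ b → Y i a ≤ Y i b)
    (hYs : ∀ i j a b, i ≠ j → (i, a) ∈ Q → (j, b) ∈ Q →
      a + (I.height i + I.height j) / 2 ≤ b → Y i a + (I.height i + I.height j) / 2 ≤ Y j b)
    (hYl : ∀ i a, (i, a) ∈ Q → Y i a ∈ I.horizontalLines)
    {p q : Fin k → ℝ × ℝ} {S : List (RobotMove k)} (h : I.Leads p S q)
    (hP : visited Prod.fst p S ⊆ P) (hQ : visited Prod.snd p S ⊆ Q) :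
    ∃ S', S'.length ≤ S.length ∧
      I.Leads (fun i => (X i (p i).1, Y i (p i).2)) S' (fun i => (X i (q i).1, Y i (q i).2)) ∧
      I.MovesOnGrid (fun i => (X i (p i).1, Y i (p i).2)) S' := by
  induction S generalizing p with
  | nil => obtain rfl : p = q := h; exact ⟨[], le_rfl, rfl, trivial⟩
  | cons m S ih =>
    obtain ⟨⟨hdir, hdist, hcol⟩, hS⟩ := h
    obtain ⟨S', hlen, hlead, hgrid⟩ := ih hS (Finset.union_subset_right hP)
      (Finset.union_subset_right hQ)
    set i := m.robot with hi
    set c := m.apply p i with hc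
    have hcp : c = p i + m.dist • m.dir := by rw [hc, RobotMove.apply, ← hi]; simp
    have hp1 : ∀ j, (j, (p j).1) ∈ P := fun j => hP (mem_visited Prod.fst p _ j)
    have hp2 : ∀ j, (j, (p j).2) ∈ Q := fun j => hQ (mem_visited Prod.snd p _ j)
    have hc1 : (i, c.1) ∈ P := hP (Finset.mem_union_right _ (mem_visited Prod.fst _ S i))
    have hc2 : (i, c.2) ∈ Q := hQ (Finset.mem_union_right _ (mem_visited Prod.snd _ S i))
    set p' : Fin k → ℝ × ℝ := fun j => (X j (p j).1, Y j (p j).2) with hp'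
    have happ : (fun j => (X j (m.apply p j).1, Y j (m.apply p j).2)) =
        Function.update p' i (X i c.1, Y i c.2) := by
      funext j
      by_cases hj : j = i
      · subst hj; simp [hc]
      · simp [hp', RobotMove.apply, hj, ← hi]
    rw [happ] at hlead hgrid
    -- A move that the maps shrink to length zero is dropped.
    by_cases hz : (X i c.1, Y i c.2) = p' i
    · rw [hz, Function.update_eq_self] at hlead hgrid
      exact ⟨S', hlen.trans (Nat.le_succ _), hlead, hgrid⟩
    -- The new move has the direction of the old one; only its length changes.
    obtain ⟨e, he, hev, haxis⟩ : ∃ e : ℝ, 0 ≤ e ∧ (X i c.1, Y i c.2) = p' i + e • m.dir ∧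
        (m.dir.1 = 0 ∧ X i c.1 = X i (p i).1 ∨ m.dir.2 = 0 ∧ Y i c.2 = Y i (p i).2) := by
      have h1 : c.1 = (p i).1 + m.dist * m.dir.1 := by simp [hcp]
      have h2 : c.2 = (p i).2 + m.dist * m.dir.2 := by simp [hcp]
      simp only [axisDirections, Set.mem_insert_iff, Set.mem_singleton_iff] at hdir
      rcases hdir with hd | hd | hd | hd <;> rw [hd] at h1 h2 ⊢ <;>
        simp only [mul_zero, mul_one, mul_neg, add_zero] at h1 h2
      · exact ⟨X i (p i).1 - X i c.1, sub_nonneg.2 (hXm i _ _ hc1 (hp1 i) (by linarith)),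
          by simp [hp', h2], Or.inr ⟨rfl, by rw [h2]⟩⟩
      · exact ⟨X i c.1 - X i (p i).1, sub_nonneg.2 (hXm i _ _ (hp1 i) hc1 (by linarith)),
          by simp [hp', h2], Or.inr ⟨rfl, by rw [h2]⟩⟩
      · exact ⟨Y i (p i).2 - Y i c.2, sub_nonneg.2 (hYm i _ _ hc2 (hp2 i) (by linarith)),
          by simp [hp', h1], Or.inl ⟨rfl, by rw [h1]⟩⟩
      · exact ⟨Y i c.2 - Y i (p i).2, sub_nonneg.2 (hYm i _ _ (hp2 i) hc2 (by linarith)),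
          by simp [hp', h1], Or.inl ⟨rfl, by rw [h1]⟩⟩
    have he' : 0 < e := he.lt_of_ne fun h => hz (by rw [hev, ← h]; simp)
    have hma : RobotMove.apply ⟨i, m.dir, e⟩ p' = Function.update p' i (X i c.1, Y i c.2) := by
      rw [hev]; rfl
    have haxis0 : m.dir.1 = 0 ∨ m.dir.2 = 0 := haxis.imp And.left And.left
    refine ⟨⟨i, m.dir, e⟩ :: S', Nat.succ_le_succ hlen, ⟨⟨hdir, he', ?_⟩, by rwa [hma]⟩, ?_⟩
    · intro j (hj : j ≠ i)
      have hold := (not_collides_iff I p i j _ (by simpa [hdist.ne'] using haxis0)).1 (hcol j hj)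
      refine (not_collides_iff I p' i j _ (by simpa [he'.ne'] using haxis0)).2 ?_
      have hn1 : (p' i).1 + (e • m.dir).1 = X i c.1 := (congrArg Prod.fst hev).symm
      have hn2 : (p' i).2 + (e • m.dir).2 = Y i c.2 := (congrArg Prod.snd hev).symm
      rw [← Prod.fst_add, ← Prod.snd_add, ← hcp] at hold
      rw [hn1, hn2]
      exact hold.imp (fun h => h.map hXs hj.symm (hp1 i) hc1 (hp1 j))
        fun h => h.map hYs hj.symm (hp2 i) hc2 (hp2 j)
    · refine ⟨⟨⟨hXl _ _ (hp1 i), hYl _ _ (hp2 i)⟩, ?_, ?_⟩, by rwa [hma]⟩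
      · simp only [hma, Function.update_self]
        exact ⟨hXl _ _ hc1, hYl _ _ hc2⟩
      · simp only [hma, Function.update_self]
        rcases haxis with ⟨-, h⟩ | ⟨-, h⟩
        · refine ⟨{q | q.1 = X i (p i).1}, Or.inl ⟨_, hXl _ _ (hp1 i), rfl⟩, ?_⟩
          rintro q ⟨r, t, -, -, hrt, rfl⟩
          simp only [Set.mem_ofPred_eq, Prod.fst_add, Prod.smul_fst, smul_eq_mul, h, hp']
          rw [← add_mul, hrt, one_mul]
        · refine ⟨{q | q.2 = Y i (p i).2}, Or.inr ⟨_, hYl _ _ (hp2 i), rfl⟩, ?_⟩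
          rintro q ⟨r, t, -, -, hrt, rfl⟩
          simp only [Set.mem_ofPred_eq, Prod.snd_add, Prod.smul_snd, smul_eq_mul, h, hp']
          rw [← add_mul, hrt, one_mul]

theorem exists_optimal_on_grid (I : RectMP k)
    (h : ∃ S, I.IsValidSchedule S ∧ S.length ≤ I.moveBound) :
    ∃ S, I.IsOptimalSchedule S ∧ I.MovesOnGrid I.start S := by
  obtain ⟨S₀, hS₀, hlen₀⟩ := h
  obtain ⟨S, hS, hmin⟩ := exists_minimalFor_of_wellFoundedLT I.IsValidSchedule List.length ⟨S₀, hS₀⟩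
  have hopt : ∀ S', I.IsValidSchedule S' → S.length ≤ S'.length := fun S' hS' =>
    (le_total S.length S'.length).elim id (hmin hS')
  have hlen := (hopt S₀ hS₀).trans hlen₀
  obtain ⟨X, hX1, hX2, hXm, hXs, hXl⟩ := exists_lineCoords_map (fun i => (I.start i).1)
    (fun i => (I.final i).1) I.width I.width_pos I.moveBound (visited Prod.fst I.start S)
    (mem_visited Prod.fst _ _) (Leads.mem_visited_end Prod.fst hS)
    ((card_visited_sdiff_le Prod.fst _ _).trans hlen)
  obtain ⟨Y, hY1, hY2, hYm, hYs, hYl⟩ := exists_lineCoords_map (fun i => (I.start i).2)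
    (fun i => (I.final i).2) I.height I.height_pos I.moveBound (visited Prod.snd I.start S)
    (mem_visited Prod.snd _ _) (Leads.mem_visited_end Prod.snd hS)
    ((card_visited_sdiff_le Prod.snd _ _).trans hlen)
  obtain ⟨S', hlen', hlead, hgrid⟩ :=
    Leads.exists_on_grid hXm hXs hXl hYm hYs hYl hS subset_rfl subset_rfl
  simp only [hX1, hX2, hY1, hY2, Prod.mk.eta] at hlead hgrid
  exact ⟨S', ⟨hlead, fun T hT => hlen'.trans (hopt T hT)⟩, hgrid⟩

/-! ### Counting the lines -/

theorem four_mul_choose_add_le (k n : ℕ) (hk : 0 < k) :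
    2 * k + 4 * k ^ 2 * (k + n).choose n ≤ k ^ 3 * 2 ^ (k + (n + 1) + 1) := by
  have hpow : 2 ^ (k + (n + 1) + 1) = 4 * 2 ^ (k + n) := by ring
  rw [hpow]
  obtain rfl | hk : k = 1 ∨ 2 ≤ k := by omega
  · -- The bound `2 ^ (k + n)` for the binomial coefficient is too weak here.
    have h1 : (1 + n).choose n = n + 1 := by rw [add_comm, Nat.choose_succ_self_right]
    have h2 : n + 1 ≤ 2 ^ n := Nat.lt_two_pow_self
    rw [h1, pow_add]
    omega
  · have h1 := Nat.choose_le_two_pow (k + n) n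
    have h2 : 1 ≤ 2 ^ (k + n) := Nat.one_le_two_pow
    set Q := 2 ^ (k + n)
    calc 2 * k + 4 * k ^ 2 * (k + n).choose n ≤ 4 * k ^ 2 * Q + 4 * k ^ 2 * Q := by
          refine add_le_add ?_ (Nat.mul_le_mul_left _ h1)
          nlinarith [Nat.mul_le_mul_left (4 * k ^ 2) h2]
      _ = k ^ 2 * 2 * (4 * Q) := by ring
      _ ≤ k ^ 2 * k * (4 * Q) := Nat.mul_le_mul_right _ (Nat.mul_le_mul_left _ hk)
      _ = k ^ 3 * (4 * Q) := by ring

theorem encard_lineCoords_le (s f d : Fin k → ℝ) (n : ℕ) :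
    (lineCoords s f d n).encard ≤ ((k ^ 3 * 2 ^ (k + n + 1) : ℕ) : ℕ∞) := by
  classical
  rcases Nat.eq_zero_or_pos k with rfl | hk
  · have : lineCoords s f d n = ∅ := by
      ext x
      simp [lineCoords]
    simp [this]
  set B : Finset ℝ := (Finset.univ : Finset (Fin k × Bool)).image
    fun x => if x.2 then s x.1 else f x.1 with hB
  have hBc : B.card ≤ 2 * k := Finset.card_image_le.trans (by simp [mul_comm])
  have hBm : ∀ x, (∃ a, x = s a ∨ x = f a) → x ∈ B := by
    rintro x ⟨a, rfl | rfl⟩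
    · exact Finset.mem_image.2 ⟨(a, true), by simp⟩
    · exact Finset.mem_image.2 ⟨(a, false), by simp⟩
  cases n with
  | zero =>
    have hsub : lineCoords s f d 0 ⊆ B := by
      rintro x (hx | ⟨a, b, -, c, M, hM, -⟩)
      · exact hBm x hx
      · omega
    refine (Set.encard_le_encard hsub).trans ?_
    rw [Set.encard_coe_eq_coe_finsetCard]
    refine Nat.cast_le.2 (hBc.trans ?_)
    calc 2 * k ≤ k ^ 3 * 2 := by nlinarith [Nat.le_self_pow (n := 3) (by norm_num) k]
      _ ≤ k ^ 3 * 2 ^ (k + 0 + 1) :=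
        Nat.mul_le_mul_left _ (Nat.le_self_pow (by omega) 2)
  | succ n =>
    -- A multiset of at most `n` robots is padded with `none` to one of exactly `n` elements.
    set C : Finset ℝ :=
      (Finset.univ : Finset ((Fin k × Bool) × (Fin k × Bool) × Sym (Option (Fin k)) n)).image
      fun x => (if x.1.2 then s x.1.1 else f x.1.1) + (if x.2.1.2 then 1 else -1) *
        (d x.1.1 / 2 + d x.2.1.1 / 2 + (((x.2.2 : Multiset (Option (Fin k))).filterMap id).map d).sum)
      with hC
    have hCc : C.card ≤ 4 * k ^ 2 * (k + n).choose n := by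
      refine Finset.card_image_le.trans (le_of_eq ?_)
      rw [Finset.card_univ]
      simp only [Fintype.card_prod, Fintype.card_fin, Fintype.card_bool,
        Sym.card_sym_eq_choose, Fintype.card_option]
      rw [show k + 1 + n - 1 = k + n by omega]
      ring
    have hsub : lineCoords s f d (n + 1) ⊆ ((B ∪ C : Finset ℝ) : Set ℝ) := by
      rintro x (hx | ⟨a, b, hb, c, M, hM, hx⟩)
      · exact Finset.mem_coe.2 (Finset.mem_union_left _ (hBm x hx))
      · refine Finset.mem_coe.2 (Finset.mem_union_right _ ?_)
        obtain ⟨β, hβ⟩ : ∃ β : Bool, b = if β then s a else f a := by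
          rcases hb with h | h
          exacts [⟨true, by simpa using h⟩, ⟨false, by simpa using h⟩]
        obtain ⟨σ, hσ⟩ : ∃ σ : Bool, x = b + (if σ then 1 else -1) *
            (d a / 2 + d c / 2 + (M.map d).sum) := by
          rcases hx with h | h
          exacts [⟨true, by simpa using h⟩, ⟨false, by simpa [sub_eq_add_neg] using h⟩]
        refine Finset.mem_image.2 ⟨((a, β), (c, σ),
          ⟨M.map some + Multiset.replicate (n - M.card) none, ?_⟩), Finset.mem_univ _, ?_⟩
        · simp only [Multiset.card_add, Multiset.card_map, Multiset.card_replicate]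
          omega
        · have hfm : (M.map some + Multiset.replicate (n - M.card) none).filterMap id = M := by
            rw [Multiset.filterMap_add, Multiset.filterMap_map]
            have h2 : ∀ r, (Multiset.replicate r (none : Option (Fin k))).filterMap id = 0 := by
              intro r
              induction r with
              | zero => simp
              | succ r ih => rw [Multiset.replicate_succ, Multiset.filterMap_cons_none _ _ rfl, ih]
            rw [h2, add_zero]
            exact Multiset.filterMap_some M
          simp only [Sym.coe_mk, hfm]
          rw [hσ, hβ]
    refine (Set.encard_le_encard hsub).trans ?_
    rw [Set.encard_coe_eq_coe_finsetCard]
    exact Nat.cast_le.2 <| (Finset.card_union_le _ _).trans <|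
      (add_le_add hBc hCc).trans (four_mul_choose_add_le k n hk)

end RectMP

theorem mainTheorem2 {k : ℕ} (I : RectMP k) :
    ((∃ S, I.IsValidSchedule S ∧ S.length ≤ I.moveBound) →
      ∃ S, I.IsOptimalSchedule S ∧ I.MovesOnGrid I.start S) ∧
    I.verticalLines.encard ≤ ((k ^ 3 * 2 ^ (k + I.moveBound + 1) : ℕ) : ℕ∞) ∧
    I.horizontalLines.encard ≤ ((k ^ 3 * 2 ^ (k + I.moveBound + 1) : ℕ) : ℕ∞) :=
  ⟨I.exists_optimal_on_grid, RectMP.encard_lineCoords_le _ _ _ _,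
    RectMP.encard_lineCoords_le _ _ _ _⟩
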